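/- Let $p$ be an odd prime, $q=p^f$ a power of $p$ with $f\ge 1$, let $n\ge 0$ and $i\ge 0$ be integers, and let $V=\mathbb{F}_q^{2n+1}$ carry the symmetric bilinear form whose Gram matrix $M$ has entries $1$ on the antidiagonal and $0$ elsewhere. Put $$G^*=\mathrm{SO}_{2n+1}(q)=\{g\in \mathrm{GL}_{2n+1}(q) : g^tMg=M,\ \det g=1\}$$ and let $\sigma=F_p^i$ be the field automorphism $(g_{ab})\mapsto (g_{ab}^{p^i})$ of $G^*$. For a monic polynomial $\Gamma\in\mathbb{F}_q[X]$ with $\Gamma(0)\neq 0$ let $\Gamma^*$ be the monic polynomial whose roots are the inverses of the roots of $\Gamma$. Let $\mathcal{F}=\mathcal{F}_0\cup\mathcal{F}_1\cup\mathcal{F}_2$, where $\mathcal{F}_0=\{X-1,X+1\}$, $\mathcal{F}_1$ is the set of monic irreducible $\Gamma\neq X,\,X\pm1$ with $\Gamma=\Gamma^*$, and $\mathcal{F}_2$ is the set of products $\Delta\Delta^*$ with $\Delta\neq X,\,X\pm1$ monic irreducible and $\Delta\neq\Delta^*$. For $\Gamma\in\mathcal{F}$ let $\sigma(\Gamma)$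 be the polynomial obtained by raising the coefficients of $\Gamma$ to the power $p^i$. For a semisimple element $s\in G^*$ and $\Gamma\in\mathcal{F}$, let $m_\Gamma(s)$ be the multiplicity of $\Gamma$ as an elementary divisor of $s$, i.e. the largest $m$ such that $\Gamma^m$ divides the characteristic polynomial of $s$. Let $V_\Gamma(s)=\ker\Gamma(s)$, a nondegenerate subspace of $V$, and let $\eta_\Gamma(s)\in\{1,-1\}$ be its type: it is $1$ if $V_\Gamma(s)$ is an orthogonal sum of hyperbolic planes, together with a line spanned by a vector of norm $1$ if its dimension is odd, and $-1$ otherwise. Let $s$ be a semisimple element of $G^*$. Then: 1. For every $\Gamma\in\mathcal{F}$, the polynomial $\sigma(\Gamma)$ lies in $\mathcal{F}$, its roots in an algebraic closure of $\mathbb{F}_q$ are, with multiplicity, the $p^i$-th powers of the roots of $\Gamma$, and $$m_{\sigma(\Gamma)}(\sigma(s))=m_\Gamma(s),\qquad \eta_{\sigma(\Gamma)}(\sigma(s))=\eta_\Gamma(s).$$ 2. The element $s^{p^i}$ is conjugate to $\sigma(s)$ in $G^*$. 3. The subgroups $\langle s\rangle$ and $\langle\sigma(s)\rangle$ are conjugate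 in $G^*$. -/

import Mathlib

namespace OddOrth

open Polynomial

/-- The antidiagonal matrix with entries `1`: the Gram matrix of an orthogonal sum of
hyperbolic planes, together with one line `⟨1⟩` when `d` is odd. -/
def splitGram (k : Type*) [Field k] (d : ℕ) : Matrix (Fin d) (Fin d) k :=
  Matrix.of fun a b => if b = Fin.rev a then 1 else 0

/-- `SO_{2n+1}(k)`: the matrices `g` with `gᵗ M g = M` and `det g = 1`, where `M` is the
antidiagonal Gram matrix of the orthogonal space `k^{2n+1}`. -/
def SO (k : Type*) [Field k] (n : ℕ) : Subgroup (GL (Fin (2 * n + 1)) k) where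
  carrier := {g | (g : Matrix (Fin (2 * n + 1)) (Fin (2 * n + 1)) k).transpose *
      splitGram k (2 * n + 1) * (g : Matrix (Fin (2 * n + 1)) (Fin (2 * n + 1)) k) =
        splitGram k (2 * n + 1) ∧
      (g : Matrix (Fin (2 * n + 1)) (Fin (2 * n + 1)) k).det = 1}
  one_mem' := by simp
  mul_mem' := by
    rintro a b ⟨ha, ha'⟩ ⟨hb, hb'⟩
    refine ⟨?_, by simp [ha', hb']⟩
    rw [Units.val_mul, Matrix.transpose_mul]
    calc _ = (b : Matrix (Fin (2 * n + 1)) (Fin (2 * n + 1)) k).transpose *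
          ((a : Matrix (Fin (2 * n + 1)) (Fin (2 * n + 1)) k).transpose *
            splitGram k (2 * n + 1) * (a : Matrix (Fin (2 * n + 1)) (Fin (2 * n + 1)) k)) *
          (b : Matrix (Fin (2 * n + 1)) (Fin (2 * n + 1)) k) := by
            simp only [Matrix.mul_assoc]
      _ = _ := by rw [ha, hb]
  inv_mem' := by
    rintro a ⟨ha, ha'⟩
    have h1 : (a : Matrix (Fin (2 * n + 1)) (Fin (2 * n + 1)) k) *
        ((a⁻¹ : GL (Fin (2 * n + 1)) k) : Matrix (Fin (2 * n + 1)) (Fin (2 * n + 1)) k) = 1 :=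
      a.mul_inv
    refine ⟨?_, ?_⟩
    · have h2 : ((a⁻¹ : GL (Fin (2 * n + 1)) k) :
            Matrix (Fin (2 * n + 1)) (Fin (2 * n + 1)) k).transpose *
          (a : Matrix (Fin (2 * n + 1)) (Fin (2 * n + 1)) k).transpose = 1 := by
        rw [← Matrix.transpose_mul, h1, Matrix.transpose_one]
      nth_rewrite 1 [← ha]
      calc _ = (((a⁻¹ : GL (Fin (2 * n + 1)) k) :
            Matrix (Fin (2 * n + 1)) (Fin (2 * n + 1)) k).transpose *
          (a : Matrix (Fin (2 * n + 1)) (Fin (2 * n + 1)) k).transpose) *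
            splitGram k (2 * n + 1) *
            ((a : Matrix (Fin (2 * n + 1)) (Fin (2 * n + 1)) k) *
              ((a⁻¹ : GL (Fin (2 * n + 1)) k) :
                Matrix (Fin (2 * n + 1)) (Fin (2 * n + 1)) k)) := by
              simp only [Matrix.mul_assoc]
        _ = _ := by rw [h1, h2, Matrix.one_mul, Matrix.mul_one]
    · have h3 := congrArg Matrix.det h1
      rw [Matrix.det_mul, ha', one_mul, Matrix.det_one] at h3
      exact h3

/-- Field endomorphisms fix the antidiagonal Gram matrix. -/
theorem splitGram_map {k : Type*} [Field k] (φ : k →+* k) (d : ℕ) :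
    (splitGram k d).map φ = splitGram k d := by
  ext a b
  simp only [splitGram, Matrix.map_apply, Matrix.of_apply]
  split_ifs <;> simp

/-- The field automorphism `σ = F_p ^ i` of `SO_{2n+1}(k)`, `(g_{ab}) ↦ (g_{ab} ^ p ^ i)`. -/
noncomputable def fieldAut (p : ℕ) [Fact p.Prime] (k : Type*) [Field k] [CharP k p]
    (n i : ℕ) : SO k n →* SO k n :=
  ((Matrix.GeneralLinearGroup.map (iterateFrobenius k p i)).comp (SO k n).subtype).codRestrict
    (SO k n) (by
      rintro ⟨g, hg, hg'⟩
      refine ⟨?_, ?_⟩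
      · have h := congrArg (fun A => A.map (iterateFrobenius k p i)) hg
        simp only [Matrix.map_mul, splitGram_map] at h
        exact h
      · have h := congrArg (iterateFrobenius k p i) hg'
        rw [RingHom.map_det, map_one] at h
        exact h)

/-- An element of `SO_{2n+1}(k)` as a linear operator on `k^{2n+1}`. -/
noncomputable def toEnd {k : Type*} [Field k] {n : ℕ} (s : SO k n) :
    Module.End k (Fin (2 * n + 1) → k) :=
  Matrix.toLin' ((s : GL (Fin (2 * n + 1)) k) : Matrix (Fin (2 * n + 1)) (Fin (2 * n + 1)) k)

/-- For monic `Γ` with `Γ(0) ≠ 0`: the monic polynomial whose roots are the inverses of the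
roots of `Γ`. -/
noncomputable def dualPoly {k : Type*} [Field k] (Γ : k[X]) : k[X] :=
  C (Γ.coeff 0)⁻¹ * Γ.reverse

/-- `𝓕₀ = {X - 1, X + 1}`. -/
noncomputable def F0 (k : Type*) [Field k] : Set k[X] := {X - 1, X + 1}

/-- The self-dual monic irreducible polynomials other than `X`, `X - 1`, `X + 1`. -/
def F1 (k : Type*) [Field k] : Set k[X] :=
  {Γ | Γ.Monic ∧ Irreducible Γ ∧ Γ ≠ X ∧ Γ ≠ X - 1 ∧ Γ ≠ X + 1 ∧ Γ = dualPoly Γ}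

/-- The products `Δ Δ*` for monic irreducible `Δ ≠ Δ*` other than `X`, `X - 1`, `X + 1`. -/
def F2 (k : Type*) [Field k] : Set k[X] :=
  {Γ | ∃ Δ : k[X], Δ.Monic ∧ Irreducible Δ ∧ Δ ≠ X ∧ Δ ≠ X - 1 ∧ Δ ≠ X + 1 ∧
    Δ ≠ dualPoly Δ ∧ Γ = Δ * dualPoly Δ}

/-- The set `𝓕 = 𝓕₀ ∪ 𝓕₁ ∪ 𝓕₂` of elementary divisors. -/
def elemDivisors (k : Type*) [Field k] : Set k[X] := F0 k ∪ F1 k ∪ F2 k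

/-- `σ(Γ)` for `σ = F_p ^ i`: apply `x ↦ x ^ p ^ i` to the coefficients of `Γ`. -/
noncomputable def fieldPoly (p : ℕ) [Fact p.Prime] {k : Type*} [Field k] [CharP k p]
    (i : ℕ) (Γ : k[X]) : k[X] :=
  Γ.map (iterateFrobenius k p i)

/-- `m_Γ(s)`: the multiplicity of the elementary divisor `Γ` in `s`, that is, the largest `m`
such that `Γ ^ m` divides the characteristic polynomial of `s`. -/
noncomputable def mult {k : Type*} [Field k] {n : ℕ} (Γ : k[X]) (s : SO k n) : ℕ :=
  multiplicity Γ (toEnd s).charpoly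

/-- `V_Γ(s)`, the `Γ`-primary component of `k^{2n+1}` for a semisimple element `s`. -/
noncomputable def primaryPart {k : Type*} [Field k] {n : ℕ} (Γ : k[X]) (s : SO k n) :
    Submodule k (Fin (2 * n + 1) → k) :=
  LinearMap.ker (aeval (toEnd s) Γ)

open Classical in
/-- The type of a nondegenerate subspace `W` of a space with a symmetric bilinear form over a
finite field of odd characteristic: `+1` if `W` is an orthogonal sum of hyperbolic planes,
plus a line `⟨1⟩` if `dim W` is odd, and `-1` otherwise. -/
noncomputable def wittType {k V : Type*} [Field k] [AddCommGroup V] [Module k V]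
    (B : LinearMap.BilinForm k V) (W : Submodule k V) : ℤˣ :=
  if ∃ b : Module.Basis (Fin (Module.finrank k W)) k W,
      ∀ a c, B (b a : V) (b c : V) = splitGram k (Module.finrank k W) a c
  then 1 else -1

/-- `η_Γ(s)`: the type of the orthogonal space `V_Γ(s)`. -/
noncomputable def eta {k : Type*} [Field k] {n : ℕ} (Γ : k[X]) (s : SO k n) : ℤˣ :=
  wittType (Matrix.toBilin' (splitGram k (2 * n + 1))) (primaryPart Γ s)

end OddOrth

/-! Write Q = p^i and let φ be coordinatewise Frobenius x ↦ x^Q, which fixes the Gram matrix and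
carries s to σ(s). Applying it to Γ, ker Γ(s) and a split basis gives part 1.

For part 2 it suffices to find a Q-semilinear θ with θ s = s^Q θ and B(θx, θy) = B(x, y)^Q
(`hasFrobeniusLift`). Then φ θ⁻¹ is a linear isometry conjugating s^Q to σ(s), and a sign puts it in
SO because the dimension is odd.

To build θ, split V into nondegenerate cyclic s-spaces. Such a space is E = k[s] with form l(x
τ(y)), where τ sends s to s⁻¹ and E is a product of finite fields. Let T be the sum of their traces
to k; then l = T(a ·) with τ(a) = a. As T commutes with Frobenius, l(x)^Q = l(a^(Q-1) x^Q). Since Q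
is odd, a^(Q-1) = b τ(b) for b = a^((Q-1)/2), so θ(x) = b x^Q works (`exists_norm_twist`,
`HasFrobeniusLift.of_cyclic`).

Part 3 follows because a semisimple s has order prime to p, so s^Q generates ⟨s⟩. -/

/-! ### Trace forms on finite reduced algebras -/

open Polynomial in
/-- A finite reduced algebra over a finite field carries a nondegenerate linear form that
commutes with Frobenius and is invariant under all automorphisms. -/
theorem exists_nondegenerate_invariant_form (p : ℕ) [Fact p.Prime] (k E : Type*) [Field k] [Finite k]
    [CharP k p] [CommRing E] [Algebra k E] [Module.Finite k E] [IsReduced E] :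
    ∃ T : E →ₗ[k] k, (∀ x, (∀ y, T (x * y) = 0) → x = 0) ∧
      (∀ (i : ℕ) (x : E), T (x ^ p ^ i) = T x ^ p ^ i) ∧
      ∀ (τ : E ≃ₐ[k] E) (x : E), T (τ x) = T x := by
  classical
  have : IsArtinianRing E := IsArtinianRing.of_finite k E
  have := Fintype.ofFinite (MaximalSpectrum E)
  let : ∀ m : MaximalSpectrum E, Field (E ⧸ m.asIdeal) := fun m => Ideal.Quotient.field _
  have : ∀ m : MaximalSpectrum E, Finite (E ⧸ m.asIdeal) := fun m =>
    Module.finite_of_finite k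
  let q : ∀ m : MaximalSpectrum E, E →ₐ[k] (E ⧸ m.asIdeal) := fun m => Ideal.Quotient.mkₐ k m.asIdeal
  let T : E →ₗ[k] k := ∑ m : MaximalSpectrum E,
    (Algebra.trace k (E ⧸ m.asIdeal)).comp (q m).toLinearMap
  have hT : ∀ x, T x = ∑ m : MaximalSpectrum E, Algebra.trace k (E ⧸ m.asIdeal) (q m x) := by
    intro x; simp [T]
  refine ⟨T, ?_, ?_, ?_⟩
  · intro x hx
    apply (IsArtinianRing.equivPi E).injective
    rw [map_zero]
    funext m
    change q m x = 0
    refine (traceForm_nondegenerate k (E ⧸ m.asIdeal)).1 _ fun z => ?_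
    -- E is the product of its residue fields, so a y supported on the factor m isolates one trace
    -- form, nondegenerate by separability.
    obtain ⟨y, hy⟩ := (IsArtinianRing.equivPi E).surjective (Pi.single m z)
    have hy' : ∀ m', q m' y = (Pi.single m z : ∀ m' : MaximalSpectrum E, E ⧸ m'.asIdeal) m' :=
      fun m' => congrFun hy m'
    have h := hx y
    rw [hT, Finset.sum_eq_single m] at h
    · rw [map_mul, hy', Pi.single_eq_same] at h
      exact h
    · intro m' _ hm
      rw [map_mul, hy', Pi.single_eq_of_ne hm, mul_zero, map_zero]
    · simp
  · intro i x
    rw [hT, hT, sum_pow_char_pow]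
    refine Finset.sum_congr rfl fun m _ => ?_
    have : CharP (E ⧸ m.asIdeal) p := charP_of_injective_algebraMap' k p
    -- Frobenius is an automorphism of both finite fields, compatible with the inclusion, so it
    -- commutes with the trace.
    have h := Algebra.trace_eq_of_equiv_equiv (iterateFrobeniusEquiv k p i)
      (iterateFrobeniusEquiv (E ⧸ m.asIdeal) p i)
      (by ext a; simp [iterateFrobenius_def]) (q m x)
    have h' := congrArg (iterateFrobeniusEquiv k p i) h
    rw [RingEquiv.apply_symm_apply] at h'
    rw [map_pow]
    exact h'.symm
  · intro τ x
    rw [hT, hT]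
    -- τ permutes the residue fields and preserves their traces, so it only reorders the sum.
    let e : MaximalSpectrum E ≃ MaximalSpectrum E :=
      { toFun := fun m => ⟨m.asIdeal.map τ.toRingEquiv, Ideal.map_isMaximal_of_equiv τ.toRingEquiv⟩
        invFun := fun m => ⟨m.asIdeal.map τ.symm.toRingEquiv, Ideal.map_isMaximal_of_equiv τ.symm.toRingEquiv⟩
        left_inv := fun m => by
          ext1; exact Ideal.map_of_equiv τ.toRingEquiv
        right_inv := fun m => by
          ext1; exact Ideal.map_of_equiv τ.symm.toRingEquiv }
    rw [← e.sum_comp]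
    refine Finset.sum_congr rfl fun m _ => ?_
    have h := Algebra.trace_eq_of_algEquiv
      (Ideal.quotientEquivAlg m.asIdeal (e m).asIdeal τ rfl) (q m x)
    exact h

/-- A `τ`-invariant linear form on a finite reduced algebra changes under Frobenius by a norm
of `τ`. -/
theorem exists_norm_twist (p : ℕ) [Fact p.Prime] (hp : p ≠ 2) (i : ℕ) {k E : Type*} [Field k]
    [Finite k] [CharP k p] [CommRing E] [Algebra k E] [Module.Finite k E] [IsReduced E]
    (τ : E →ₐ[k] E) (hτ : ∀ x, τ (τ x) = x) (l : E →ₗ[k] k) (hl : ∀ x, l (τ x) = l x) :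
    ∃ b : E, ∀ x, l (x ^ p ^ i * (b * τ b)) = l x ^ p ^ i := by
  obtain ⟨T, hT, hF, hA⟩ := exists_nondegenerate_invariant_form p k E
  let τ' : E ≃ₐ[k] E := AlgEquiv.ofAlgHom τ τ (AlgHom.ext hτ) (AlgHom.ext hτ)
  let S : E →ₗ[k] Module.Dual k E := (LinearMap.mul k E).compr₂ T
  have hS : Function.Injective S := by
    rw [← LinearMap.ker_eq_bot, LinearMap.ker_eq_bot']
    exact fun x hx => hT x fun y => LinearMap.congr_fun hx y
  obtain ⟨a, ha⟩ := (LinearMap.injective_iff_surjective_of_finrank_eq_finrank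
    (Subspace.dual_finrank_eq (K := k) (V := E)).symm).1 hS l
  have ha' : ∀ x, T (a * x) = l x := fun x => LinearMap.congr_fun ha x
  have hτa : τ a = a := by
    rw [← sub_eq_zero]
    refine hT _ fun y => ?_
    rw [sub_mul, map_sub, ha', ← hl, ← ha', sub_eq_zero]
    conv_rhs => rw [← hA τ']
    change _ = T (τ (a * τ y))
    rw [map_mul τ, hτ]
  -- With p^i = 2c + 1 and τ(a) = a, the norm of a^c is a^(2c) = a^(p^i - 1), the factor needed to
  -- turn a into a^(p^i).
  obtain ⟨c, hc⟩ : Odd (p ^ i) := ((Fact.out : p.Prime).odd_of_ne_two hp).pow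
  refine ⟨a ^ c, fun x => ?_⟩
  rw [map_pow, hτa, ← ha', ← ha', ← hF, mul_pow]
  congr 1
  rw [hc]; ring

/-! ### Frobenius lifts on cyclic spaces -/

open Polynomial in
theorem bilin_aeval_adjoint {k V : Type*} [Field k] [AddCommGroup V] [Module k V]
    (B : LinearMap.BilinForm k V) {u w : Module.End k V} (h : ∀ x y, B (u x) y = B x (w y))
    (f : k[X]) (x y : V) : B (aeval u f x) y = B x (aeval w f y) := by
  induction f using Polynomial.induction_on generalizing x y with
  | C a => simp [Module.algebraMap_end_apply]
  | add f g hf hg => simp [hf, hg]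
  | monomial n a ih =>
    rw [pow_succ, ← mul_assoc, map_mul (aeval w), aeval_X, mul_comm _ X, map_mul (aeval u), aeval_X,
      Module.End.mul_apply, Module.End.mul_apply, ← ih, h]

/-- A `p ^ i`-Frobenius semilinear self-map of `(V, B)` that preserves `B` up to Frobenius and
intertwines `s` with `s ^ p ^ i`. -/
def HasFrobeniusLift (p i : ℕ) {k V : Type*} [Field k] [AddCommGroup V] [Module k V]
    (B : LinearMap.BilinForm k V) (s : Module.End k V) : Prop :=
  ∃ θ : V →+ V, (∀ (c : k) v, θ (c • v) = c ^ p ^ i • θ v) ∧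
    (∀ v, θ (s v) = (s ^ p ^ i) (θ v)) ∧ ∀ x y, B (θ x) (θ y) = B x y ^ p ^ i

open Polynomial in
/-- The isometry of a nondegenerate cyclic space has a Frobenius lift. -/
theorem HasFrobeniusLift.of_cyclic (p : ℕ) [Fact p.Prime] (hp : p ≠ 2) (i : ℕ) {k V : Type*}
    [Field k] [Finite k] [CharP k p] [AddCommGroup V] [Module k V] [Module.Finite k V]
    {B : LinearMap.BilinForm k V} (hB : B.IsSymm) (hnd : ∀ x, (∀ y, B x y = 0) → x = 0)
    {s : Module.End k V} (hs : s.IsSemisimple) (hsB : ∀ x y, B (s x) (s y) = B x y)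
    (v : V) (hv : ∀ x, ∃ f : k[X], x = aeval s f v) : HasFrobeniusLift p i B s := by
  let E := k[X] ⧸ RingHom.ker (aeval s : k[X] →ₐ[k] Module.End k V)
  let ρ : E →ₐ[k] Module.End k V := Ideal.kerLiftAlg (aeval s : k[X] →ₐ[k] Module.End k V)
  have hρ : Function.Injective ρ := Ideal.kerLiftAlg_injective (aeval s : k[X] →ₐ[k] Module.End k V)
  let π : k[X] →ₐ[k] E := Ideal.Quotient.mkₐ k _
  have hπ : Function.Surjective π := Ideal.Quotient.mkₐ_surjective k _
  have hρπ : ∀ f, ρ (π f) = aeval s f := fun f => rfl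
  have : Module.Finite k E := Module.Finite.of_injective ρ.toLinearMap hρ
  have : IsReduced E := by
    refine ⟨fun e he => hρ ?_⟩
    obtain ⟨f, rfl⟩ := hπ e
    rw [map_zero, hρπ]
    exact Module.End.eq_zero_of_isNilpotent_isSemisimple (hρπ f ▸ he.map ρ) (hs.aeval f)
  -- the inverse of `s`
  have hinj : Function.Injective s := by
    rw [← LinearMap.ker_eq_bot, LinearMap.ker_eq_bot']
    intro x hx
    refine hnd x fun y => ?_
    rw [← hsB, hx, map_zero, LinearMap.zero_apply]
  -- The inverse of s is itself a polynomial in s: multiplication by the class of X is injective on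
  -- the finite-dimensional E, hence surjective.
  obtain ⟨r, hr⟩ : ∃ r : E, π X * r = 1 := by
    have : Function.Injective (LinearMap.mulLeft k (π X)) := by
      rw [← LinearMap.ker_eq_bot, LinearMap.ker_eq_bot']
      intro e he
      apply hρ
      have h := congrArg ρ he
      rw [LinearMap.mulLeft_apply, map_mul, hρπ, aeval_X, map_zero] at h
      ext x
      exact hinj (by simpa using LinearMap.congr_fun h x)
    exact LinearMap.surjective_of_injective this 1
  have hr' : s * ρ r = 1 := by
    rw [← map_one ρ, ← hr, map_mul, hρπ, aeval_X]
  have hadj : ∀ x y, B (s x) y = B x (ρ r y) := by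
    intro x y
    rw [← hsB x, ← Module.End.mul_apply, hr', Module.End.one_apply]
  have hadj' : ∀ (f : k[X]) x y, B (ρ (π f) x) y = B x (ρ (aeval r f) y) := by
    intro f x y
    rw [hρπ, bilin_aeval_adjoint B hadj, ← aeval_algHom_apply]
  -- τ is the adjoint involution s ↦ s⁻¹. It is well defined because f(s⁻¹) is adjoint to f(s), so
  -- both vanish together.
  let τ : E →ₐ[k] E := Ideal.Quotient.liftₐ _ (aeval r) (by
    intro f hf
    apply hρ
    rw [map_zero]
    ext y
    refine hnd _ fun x => ?_
    rw [hB.eq, ← hadj', hρπ, (RingHom.mem_ker).1 hf]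
    simp)
  have hτ : ∀ e x y, B (ρ e x) y = B x (ρ (τ e) y) := by
    intro e
    obtain ⟨f, rfl⟩ := hπ e
    exact hadj' f
  have hττ : ∀ e, τ (τ e) = e := by
    intro e
    apply hρ
    ext x
    rw [← sub_eq_zero]
    refine hnd _ fun y => ?_
    rw [map_sub, LinearMap.sub_apply, sub_eq_zero, hB.eq, ← hτ, hB.eq, ← hτ]
  let l : E →ₗ[k] k := (B.flip v).comp ((LinearMap.applyₗ v).comp ρ.toLinearMap)
  have hl : ∀ e, l e = B (ρ e v) v := fun e => rfl
  obtain ⟨b, hb⟩ := exists_norm_twist p hp i τ hττ l (by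
    intro e
    rw [hl, hl, hB.eq, ← hτ])
  let ε : E →ₗ[k] V := (LinearMap.applyₗ v).comp ρ.toLinearMap
  have hε : ∀ e, ε e = ρ e v := fun e => rfl
  have hεmul : ∀ e e', ε (e * e') = ρ e (ε e') := by
    intro e e'; rw [hε, map_mul, hε, Module.End.mul_apply]
  have hεbij : Function.Bijective ε := by
    constructor
    · rw [← LinearMap.ker_eq_bot, LinearMap.ker_eq_bot']
      intro e he
      apply hρ
      ext x
      obtain ⟨f, rfl⟩ := hv x
      rw [← hρπ, ← hε, ← hεmul, mul_comm, hεmul, he, map_zero, map_zero, LinearMap.zero_apply]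
    · intro x
      obtain ⟨f, rfl⟩ := hv x
      exact ⟨π f, rfl⟩
  have hBε : ∀ x y, B (ε x) (ε y) = l (x * τ y) := by
    intro x y
    rw [hl, mul_comm, map_mul, Module.End.mul_apply, hτ, hττ, hε, hε]
  let ε' : E ≃ₗ[k] V := LinearEquiv.ofBijective ε hεbij
  have hεs : ∀ e, ε'.symm (ε e) = e := fun e => ε'.symm_apply_apply e
  have hsε : ∀ e, s (ε e) = ε (π X * e) := by
    intro e
    rw [hεmul, hρπ, aeval_X]
  -- The zero space is separated because E must be nontrivial to have characteristic p.
  rcases subsingleton_or_nontrivial V with hV | hV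
  · refine ⟨0, by simp, by simp, fun x y => ?_⟩
    rw [Subsingleton.elim x 0]
    simp [(Fact.out : p.Prime).ne_zero]
  have : Nontrivial E := ρ.toRingHom.domain_nontrivial
  have : CharP E p := charP_of_injective_algebraMap' k p
  -- θ is e ↦ e^(p^i) b on E, transported to V along e ↦ e v.
  refine ⟨ε.toAddMonoidHom.comp (((AddMonoidHom.mulRight b).comp
    (iterateFrobenius E p i).toAddMonoidHom).comp ε'.symm.toLinearMap.toAddMonoidHom), ?_, ?_, ?_⟩
  · intro c x
    change ε (iterateFrobenius E p i (ε'.symm (c • x)) * b) = _ • ε (_ * b)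
    rw [← map_smul, map_smul, iterateFrobenius_def, _root_.smul_pow, smul_mul_assoc]
    rfl
  · intro x
    obtain ⟨e, rfl⟩ := hεbij.2 x
    change ε (iterateFrobenius E p i (ε'.symm (s (ε e))) * b) =
      (s ^ p ^ i) (ε (iterateFrobenius E p i (ε'.symm (ε e)) * b))
    have hspow : ∀ m e, (s ^ m) (ε e) = ε (π X ^ m * e) := by
      intro m e
      rw [hεmul, map_pow, hρπ, aeval_X]
    rw [hspow, hsε, hεs, hεs, map_mul (iterateFrobenius E p i), iterateFrobenius_def, mul_assoc]
  · intro x y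
    obtain ⟨e, rfl⟩ := hεbij.2 x
    obtain ⟨f, rfl⟩ := hεbij.2 y
    change B (ε (iterateFrobenius E p i (ε'.symm (ε e)) * b))
      (ε (iterateFrobenius E p i (ε'.symm (ε f)) * b)) = _
    rw [hεs, hεs, hBε, hBε, ← hb]
    simp only [iterateFrobenius_def, map_mul, map_pow]
    congr 1
    ring

/-! ### Orthogonal decomposition into cyclic subspaces -/

theorem HasFrobeniusLift.of_isCompl {p i : ℕ} {k V : Type*} [Fact p.Prime] [Field k] [CharP k p]
    [AddCommGroup V] [Module k V] {B : LinearMap.BilinForm k V} {s : Module.End k V}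
    {W N : Submodule k V} (h : IsCompl W N) (hWN : ∀ x ∈ W, ∀ y ∈ N, B x y = 0)
    (hNW : ∀ x ∈ N, ∀ y ∈ W, B x y = 0)
    (hW : ∀ x ∈ W, s x ∈ W) (hN : ∀ x ∈ N, s x ∈ N)
    (h₁ : HasFrobeniusLift p i (B.restrict W) (s.restrict hW))
    (h₂ : HasFrobeniusLift p i (B.restrict N) (s.restrict hN)) : HasFrobeniusLift p i B s := by
  obtain ⟨θ₁, h₁c, h₁s, h₁B⟩ := h₁
  obtain ⟨θ₂, h₂c, h₂s, h₂B⟩ := h₂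
  let e := Submodule.prodEquivOfIsCompl W N h
  have he : ∀ a b, e (a, b) = a + b := fun a b => by simp [e]
  have hes : ∀ a b, s (e (a, b)) = e (s.restrict hW a, s.restrict hN b) := fun a b => by
    simp [he]
  have hesm : ∀ m a b, (s ^ m) (e (a, b)) = e ((s.restrict hW ^ m) a, (s.restrict hN ^ m) b) := by
    intro m
    induction m with
    | zero => simp
    | succ m ih =>
      intro a b
      rw [pow_succ, Module.End.mul_apply, hes, ih, pow_succ, pow_succ]
      rfl
  have hB : ∀ a b a' b', B (e (a, b)) (e (a', b')) = B.restrict W a a' + B.restrict N b b' := by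
    intro a b a' b'
    simp [he, hWN a a.2 b' b'.2, hNW b b.2 a' a'.2]
  refine ⟨(e.toLinearMap.toAddMonoidHom.comp (θ₁.prodMap θ₂)).comp
    e.symm.toLinearMap.toAddMonoidHom, ?_, ?_, ?_⟩
  · intro c x
    obtain ⟨⟨a, b⟩, rfl⟩ := e.surjective x
    change e (Prod.map θ₁ θ₂ (e.symm (c • e (a, b)))) = _ • e (Prod.map θ₁ θ₂ (e.symm (e (a, b))))
    rw [← map_smul, ← map_smul, e.symm_apply_apply, e.symm_apply_apply]
    simp [h₁c, h₂c]
  · intro x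
    obtain ⟨⟨a, b⟩, rfl⟩ := e.surjective x
    change e (Prod.map θ₁ θ₂ (e.symm (s (e (a, b))))) =
      (s ^ p ^ i) (e (Prod.map θ₁ θ₂ (e.symm (e (a, b)))))
    rw [hes, e.symm_apply_apply, e.symm_apply_apply, Prod.map_apply, Prod.map_apply, hesm, h₁s, h₂s]
  · intro x y
    obtain ⟨⟨a, b⟩, rfl⟩ := e.surjective x
    obtain ⟨⟨a', b'⟩, rfl⟩ := e.surjective y
    change B (e (Prod.map θ₁ θ₂ (e.symm (e (a, b))))) (e (Prod.map θ₁ θ₂ (e.symm (e (a', b'))))) = _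
    rw [e.symm_apply_apply, e.symm_apply_apply, Prod.map_apply, Prod.map_apply, hB, hB, h₁B, h₂B,
      add_pow_char_pow]

/-- The cyclic subspace `k[s] v`. -/
noncomputable def cyclicSubspace {k V : Type*} [Field k] [AddCommGroup V] [Module k V]
    (s : Module.End k V) (v : V) : Submodule k V :=
  LinearMap.range ((LinearMap.applyₗ v).comp (Polynomial.aeval s).toLinearMap)

open Polynomial in
theorem mem_cyclicSubspace {k V : Type*} [Field k] [AddCommGroup V] [Module k V]
    {s : Module.End k V} {v x : V} : x ∈ cyclicSubspace s v ↔ ∃ f : k[X], aeval s f v = x :=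
  Iff.rfl

theorem self_mem_cyclicSubspace {k V : Type*} [Field k] [AddCommGroup V] [Module k V]
    (s : Module.End k V) (v : V) : v ∈ cyclicSubspace s v :=
  mem_cyclicSubspace.2 ⟨1, by simp⟩

open Polynomial in
theorem map_mem_cyclicSubspace {k V : Type*} [Field k] [AddCommGroup V] [Module k V]
    {s : Module.End k V} {v : V} : ∀ x ∈ cyclicSubspace s v, s x ∈ cyclicSubspace s v := by
  rintro _ ⟨f, rfl⟩
  exact ⟨X * f, by simp⟩

open Polynomial in
theorem aeval_mem_of_mapsTo {k V : Type*} [Field k] [AddCommGroup V] [Module k V]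
    {s : Module.End k V} {W : Submodule k V} (hW : ∀ x ∈ W, s x ∈ W) (f : k[X]) {x : V}
    (hx : x ∈ W) : aeval s f x ∈ W := by
  induction f using Polynomial.induction_on generalizing x with
  | C a => simpa [Module.algebraMap_end_apply] using W.smul_mem a hx
  | add f g hf hg => simpa using W.add_mem (hf hx) (hg hx)
  | monomial n a ih =>
    rw [pow_succ, ← mul_assoc, map_mul (aeval s), aeval_X]
    exact ih (hW x hx)

/-- By finite dimension s W = W, so every w in W is some s w' and B(w, s x) = B(w', x). -/
theorem map_mem_orthogonal {k V : Type*} [Field k] [AddCommGroup V] [Module k V]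
    [Module.Finite k V] {B : LinearMap.BilinForm k V} {s : Module.End k V}
    (hsB : ∀ x y, B (s x) (s y) = B x y) (hinj : Function.Injective s) {W : Submodule k V}
    (hW : ∀ x ∈ W, s x ∈ W) : ∀ x ∈ B.orthogonal W, s x ∈ B.orthogonal W := by
  intro x hx w hw
  obtain ⟨⟨w', hw'⟩, h⟩ := LinearMap.surjective_of_injective
    (f := s.restrict hW) (fun a b hab => Subtype.ext (hinj (congrArg Subtype.val hab))) ⟨w, hw⟩
  have h' : s w' = w := congrArg Subtype.val h
  change B w (s x) = 0
  rw [← h', hsB]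
  exact hx w' hw'

/-- A semisimple isometry of a nonzero nondegenerate space has a nonzero nondegenerate cyclic
subspace. -/
theorem exists_nondegenerate_cyclicSubspace {k V : Type*} [Field k] [AddCommGroup V] [Module k V]
    [Module.Finite k V] [Nontrivial V] (h2 : (2 : k) ≠ 0) {B : LinearMap.BilinForm k V}
    (hB : B.IsSymm) (hnd : ∀ x, (∀ y, B x y = 0) → x = 0) {s : Module.End k V}
    (hs : s.IsSemisimple) (hsB : ∀ x y, B (s x) (s y) = B x y) (hinj : Function.Injective s) :
    ∃ w ≠ 0, Disjoint (cyclicSubspace s w) (B.orthogonal (cyclicSubspace s w)) := by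
  have hB0 : B ≠ 0 := by
    rintro rfl
    obtain ⟨x, hx⟩ := exists_ne (0 : V)
    exact hx (hnd x fun y => rfl)
  have := invertibleOfNonzero h2
  obtain ⟨v, hv⟩ := LinearMap.BilinForm.exists_bilinForm_self_ne_zero hB0 ⟨fun x y => hB.eq x y⟩
  let U := cyclicSubspace s v
  have hU : ∀ x ∈ U, s x ∈ U := map_mem_cyclicSubspace
  -- U may be degenerate. Its radical R has an s-stable complement Q by semisimplicity, and w is the
  -- Q-component of v. It is nonzero, as otherwise v would lie in R, against B(v, v) ≠ 0.
  let R := U ⊓ B.orthogonal U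
  have hR : ∀ x ∈ R, s x ∈ R := fun x hx =>
    ⟨hU x hx.1, map_mem_orthogonal hsB hinj hU x hx.2⟩
  obtain ⟨Q, hQ, hRQ⟩ := Module.End.isSemisimple_iff.1 hs R hR
  obtain ⟨r, hr, w, hw, rfl⟩ := Submodule.mem_sup.1
    (hRQ.sup_eq_top ▸ Submodule.mem_top : v ∈ R ⊔ Q)
  have hrw : r + w ∈ U := self_mem_cyclicSubspace s _
  have hwU : w ∈ U := by simpa using U.sub_mem hrw hr.1
  refine ⟨w, ?_, ?_⟩
  · rintro rfl
    rw [add_zero] at hv hrw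
    exact hv (hr.2 r (by simpa using hrw))
  · rw [Submodule.disjoint_def]
    rintro x ⟨f, rfl⟩ hx
    have hxU := aeval_mem_of_mapsTo hU f hwU
    have hxQ := aeval_mem_of_mapsTo hQ f hw
    -- A vector of k[s]w orthogonal to k[s]w is orthogonal to all of U, since k[s]r lies in the
    -- radical; so it lies in R ∩ Q = 0.
    refine (Submodule.disjoint_def.1 hRQ.disjoint) _ ⟨hxU, ?_⟩ hxQ
    rintro _ ⟨g, rfl⟩
    change B (Polynomial.aeval s g (r + w)) (Polynomial.aeval s f w) = 0
    rw [map_add, map_add, LinearMap.add_apply]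
    have e1 : B (Polynomial.aeval s g w) (Polynomial.aeval s f w) = 0 := hx _ ⟨g, rfl⟩
    have e2 : B (Polynomial.aeval s g r) (Polynomial.aeval s f w) = 0 := by
      rw [hB.eq]
      exact (aeval_mem_of_mapsTo hR g hr).2 _ hxU
    rw [e1, e2, add_zero]

open Polynomial in
theorem coe_aeval_restrict {k V : Type*} [Field k] [AddCommGroup V] [Module k V]
    {s : Module.End k V} {W : Submodule k V} (hW : ∀ x ∈ W, s x ∈ W) (f : k[X]) (x : W) :
    (aeval (s.restrict hW) f x : V) = aeval s f x := by
  induction f using Polynomial.induction_on generalizing x with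
  | C a => simp [Module.algebraMap_end_apply]
  | add f g hf hg => simp [hf, hg]
  | monomial n a ih =>
    rw [pow_succ, ← mul_assoc, map_mul (aeval s), map_mul (aeval (s.restrict hW)), aeval_X, aeval_X,
      Module.End.mul_apply, Module.End.mul_apply, ih]
    rfl

/-- Every semisimple isometry of a nondegenerate symmetric bilinear space over a finite field of
odd characteristic has a Frobenius lift. -/
theorem hasFrobeniusLift (p : ℕ) [Fact p.Prime] (hp : p ≠ 2) (i : ℕ) {k : Type*} {V : Type*}
    [Field k] [Finite k] [CharP k p] [AddCommGroup V] [Module k V] [Module.Finite k V]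
    {B : LinearMap.BilinForm k V} (hB : B.IsSymm) (hnd : ∀ x, (∀ y, B x y = 0) → x = 0)
    {s : Module.End k V} (hs : s.IsSemisimple) (hsB : ∀ x y, B (s x) (s y) = B x y) :
    HasFrobeniusLift p i B s := by
  induction hd : Module.finrank k V using Nat.strong_induction_on generalizing V with
  | _ d ih =>
  rcases subsingleton_or_nontrivial V with hV | hV
  · refine ⟨0, by simp, by simp, fun x y => ?_⟩
    rw [Subsingleton.elim x 0]
    simp [(Fact.out : p.Prime).ne_zero]
  have hinj : Function.Injective s := by
    rw [← LinearMap.ker_eq_bot, LinearMap.ker_eq_bot']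
    intro x hx
    refine hnd x fun y => ?_
    rw [← hsB, hx, map_zero, LinearMap.zero_apply]
  have h2 : (2 : k) ≠ 0 := Ring.two_ne_zero (by rwa [ringChar.eq k p])
  obtain ⟨w, hw0, hw⟩ := exists_nondegenerate_cyclicSubspace h2 hB hnd hs hsB hinj
  let W := cyclicSubspace s w
  let N := B.orthogonal W
  have hW : ∀ x ∈ W, s x ∈ W := map_mem_cyclicSubspace
  have hN : ∀ x ∈ N, s x ∈ N := map_mem_orthogonal hsB hinj hW
  have hWN : IsCompl W N := (LinearMap.BilinForm.isCompl_orthogonal_iff_disjoint hB.isRefl).2 hw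
  have hWN0 : ∀ x ∈ W, ∀ y ∈ N, B x y = 0 := fun x hx y hy => hy x hx
  have hNW0 : ∀ x ∈ N, ∀ y ∈ W, B x y = 0 := fun x hx y hy => by
    rw [hB.eq]; exact hx y hy
  have key : ∀ M M' : Submodule k V, IsCompl M M' → (∀ x ∈ M, ∀ y ∈ M', B x y = 0) →
      ∀ x : M, (∀ y : M, B.restrict M x y = 0) → x = 0 := by
    intro M M' hc h x hx
    refine Subtype.ext (hnd x fun y => ?_)
    obtain ⟨a, ha, b, hb, rfl⟩ := Submodule.mem_sup.1
      (hc.sup_eq_top ▸ Submodule.mem_top : y ∈ M ⊔ M')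
    rw [map_add, h x x.2 b hb, add_zero]
    exact hx ⟨a, ha⟩
  have hsymm : ∀ M : Submodule k V, (B.restrict M).IsSymm := fun M =>
    ⟨fun x y => hB.eq x y⟩
  refine HasFrobeniusLift.of_isCompl hWN hWN0 hNW0 hW hN ?_ ?_
  · refine HasFrobeniusLift.of_cyclic p hp i (hsymm W) (key W N hWN hWN0)
      (hs.restrict hW) (fun x y => hsB x y) ⟨w, self_mem_cyclicSubspace s w⟩ ?_
    rintro ⟨_, f, rfl⟩
    refine ⟨f, Subtype.ext ?_⟩
    rw [coe_aeval_restrict]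
    rfl
  · refine ih _ ?_ (hsymm N) (key N W hWN.symm hNW0) (hs.restrict hN) (fun x y => hsB x y) rfl
    rw [← hd]
    refine Submodule.finrank_lt fun h => hw0 ?_
    have := (Submodule.disjoint_def.1 hWN.disjoint) w (self_mem_cyclicSubspace s w)
    exact this (h ▸ Submodule.mem_top)

/-! ### Elementary divisors, multiplicities and types under the field automorphism -/

namespace OddOrth

open Polynomial

theorem dualPoly_map {k : Type*} [Field k] (φ : k →+* k) (Γ : k[X]) :
    dualPoly (Γ.map φ) = (dualPoly Γ).map φ := by
  rw [dualPoly, dualPoly, Polynomial.map_mul, map_C, coeff_map, map_inv₀ φ, reverse, reverse,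
    natDegree_map, reflect_map]

theorem irreducible_map_ringEquiv {k : Type*} [Field k] (φ : k ≃+* k) {Γ : k[X]}
    (h : Irreducible Γ) : Irreducible (Γ.map (φ : k →+* k)) :=
  (MulEquiv.irreducible_iff (Polynomial.mapEquiv φ)).2 h

theorem map_mem_elemDivisors {k : Type*} [Field k] (φ : k ≃+* k) {Γ : k[X]}
    (h : Γ ∈ elemDivisors k) : Γ.map (φ : k →+* k) ∈ elemDivisors k := by
  have hinj : Function.Injective (Polynomial.map (φ : k →+* k)) := map_injective _ φ.injective
  have hX : (X : k[X]).map (φ : k →+* k) = X := map_X _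
  have hX1 : (X - 1 : k[X]).map (φ : k →+* k) = X - 1 := by simp
  have hX2 : (X + 1 : k[X]).map (φ : k →+* k) = X + 1 := by simp
  have hne : ∀ {Δ Λ : k[X]}, Λ.map (φ : k →+* k) = Λ → Δ ≠ Λ → Δ.map (φ : k →+* k) ≠ Λ :=
    fun h h' e => h' (hinj (e.trans h.symm))
  rcases h with (h | h) | ⟨Δ, h1, h2, h3, h4, h5, h6, rfl⟩
  · rcases h with rfl | rfl
    · exact Or.inl (Or.inl (Or.inl hX1))
    · exact Or.inl (Or.inl (Or.inr hX2))
  · obtain ⟨h1, h2, h3, h4, h5, h6⟩ := h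
    refine Or.inl (Or.inr ⟨h1.map _, irreducible_map_ringEquiv φ h2, hne hX h3, hne hX1 h4,
      hne hX2 h5, ?_⟩)
    rw [dualPoly_map, ← h6]
  · refine Or.inr ⟨Δ.map (φ : k →+* k), h1.map _, irreducible_map_ringEquiv φ h2, hne hX h3,
      hne hX1 h4, hne hX2 h5, ?_, ?_⟩
    · rw [dualPoly_map]
      exact fun e => h6 (hinj e)
    · rw [dualPoly_map, Polynomial.map_mul]

theorem aroots_fieldPoly (p : ℕ) [Fact p.Prime] {k : Type*} [Field k] [CharP k p] (i : ℕ)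
    (Γ : k[X]) : (fieldPoly p i Γ).aroots (AlgebraicClosure k) =
      (Γ.aroots (AlgebraicClosure k)).map (fun x => x ^ p ^ i) := by
  have : CharP (AlgebraicClosure k) p := charP_of_injective_algebraMap' k p
  have h : (algebraMap k (AlgebraicClosure k)).comp (iterateFrobenius k p i) =
      (iterateFrobenius (AlgebraicClosure k) p i).comp (algebraMap k (AlgebraicClosure k)) := by
    ext x; simp [iterateFrobenius_def]
  rw [aroots, aroots, fieldPoly, Polynomial.map_map, h, ← Polynomial.map_map,
    Splits.roots_map (IsAlgClosed.splits _)]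
  rfl

theorem map_aeval_toLin' {k : Type*} [Field k] {d : ℕ} (φ : k →+* k) (A : Matrix (Fin d) (Fin d) k)
    (f : k[X]) (v : Fin d → k) :
    aeval (Matrix.toLin' (A.map φ)) (f.map φ) (φ ∘ v) = φ ∘ (aeval (Matrix.toLin' A) f v) := by
  induction f using Polynomial.induction_on generalizing v with
  | C a => ext j; simp [Module.algebraMap_end_apply]
  | add f g hf hg => ext j; simp [hf, hg]
  | monomial n a ih =>
    rw [pow_succ, ← mul_assoc, Polynomial.map_mul, map_mul, map_mul, map_X, aeval_X, aeval_X,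
      Module.End.mul_apply, Module.End.mul_apply, ← ih]
    congr 1
    ext j
    simp [Matrix.mulVec, dotProduct]

theorem splitGram_bilin_apply {k : Type*} [Field k] {d : ℕ} (x y : Fin d → k) :
    Matrix.toBilin' (splitGram k d) x y = ∑ a, x a * y (Fin.rev a) := by
  rw [Matrix.toBilin'_apply']
  simp [Matrix.mulVec, dotProduct, splitGram]

theorem splitGram_bilin_map {k : Type*} [Field k] (φ : k →+* k) {d : ℕ} (x y : Fin d → k) :
    Matrix.toBilin' (splitGram k d) (φ ∘ x) (φ ∘ y) = φ (Matrix.toBilin' (splitGram k d) x y) := by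
  simp [splitGram_bilin_apply]

/-- Leaving the size d free lets a basis be transported without comparing ranks. -/
theorem wittType_eq_one_iff {k V : Type*} [Field k] [AddCommGroup V] [Module k V]
    {B : LinearMap.BilinForm k V} {W : Submodule k V} :
    wittType B W = 1 ↔ ∃ (d : ℕ) (b : Module.Basis (Fin d) k W),
      ∀ a c, B (b a : V) (b c : V) = splitGram k d a c := by
  rw [wittType]
  split_ifs with h
  · exact ⟨fun _ => ⟨_, h⟩, fun _ => rfl⟩
  · refine ⟨fun h' => absurd h' (by decide), ?_⟩
    rintro ⟨d, b, hb⟩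
    have hd : d = Module.finrank k W := by simp [Module.finrank_eq_card_basis b]
    subst hd
    exact absurd ⟨b, hb⟩ h

/-- Coordinatewise φ is a semilinear bijection W → W'. It takes a split basis to a split basis,
since the Gram entries 0 and 1 are fixed by φ. -/
theorem wittType_map_eq_one {k : Type*} [Field k] (φ : k ≃+* k) {m : ℕ}
    {W W' : Submodule k (Fin m → k)} (hW : ∀ v, v ∈ W ↔ φ ∘ v ∈ W')
    (h : wittType (Matrix.toBilin' (splitGram k m)) W = 1) :
    wittType (Matrix.toBilin' (splitGram k m)) W' = 1 := by
  rw [wittType_eq_one_iff] at h ⊢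
  obtain ⟨d, b, hb⟩ := h
  have : RingHomInvPair (φ : k →+* k) (φ.symm : k →+* k) := RingHomInvPair.of_ringEquiv φ
  have : RingHomInvPair (φ.symm : k →+* k) (φ : k →+* k) := RingHomInvPair.of_ringEquiv φ.symm
  let j : W ≃ₛₗ[(φ : k →+* k)] W' :=
    { toFun := fun v => ⟨φ ∘ v, (hW v).1 v.2⟩
      invFun := fun v => ⟨φ.symm ∘ v, (hW _).2 (by
        convert v.2; ext; simp)⟩
      left_inv := fun v => by ext; simp
      right_inv := fun v => by ext; simp
      map_add' := fun v w => by ext; simp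
      map_smul' := fun c v => by ext; simp }
  have hli : LinearIndependent k (fun a => j (b a)) :=
    b.linearIndependent.map_of_surjective_injectiveₛ φ j.toLinearMap.toAddMonoidHom φ.surjective
      j.injective (map_smulₛₗ j)
  have hsp : ⊤ ≤ Submodule.span k (Set.range fun a => j (b a)) := by
    intro y _
    obtain ⟨w, rfl⟩ := j.surjective y
    rw [← b.sum_repr w, map_sum]
    refine Submodule.sum_mem _ fun a _ => ?_
    rw [map_smulₛₗ]
    exact Submodule.smul_mem _ _ (Submodule.subset_span ⟨a, rfl⟩)
  refine ⟨d, Module.Basis.mk hli hsp, fun a c => ?_⟩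
  rw [Module.Basis.mk_apply, Module.Basis.mk_apply]
  refine (splitGram_bilin_map (φ : k →+* k) (b a : Fin m → k) (b c)).trans ?_
  rw [hb, ← Matrix.map_apply (f := (φ : k →+* k)), splitGram_map]

theorem wittType_map {k : Type*} [Field k] (φ : k ≃+* k) {m : ℕ}
    {W W' : Submodule k (Fin m → k)} (hW : ∀ v, v ∈ W ↔ φ ∘ v ∈ W') :
    wittType (Matrix.toBilin' (splitGram k m)) W' =
      wittType (Matrix.toBilin' (splitGram k m)) W := by
  have h : wittType (Matrix.toBilin' (splitGram k m)) W' = 1 ↔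
      wittType (Matrix.toBilin' (splitGram k m)) W = 1 := by
    refine ⟨wittType_map_eq_one φ.symm fun v => ?_, wittType_map_eq_one φ hW⟩
    rw [hW]
    refine iff_of_eq (congrArg (· ∈ W') ?_)
    ext; simp
  rcases Int.units_eq_one_or (wittType (Matrix.toBilin' (splitGram k m)) W) with h1 | h1
  · rw [h1, h, h1]
  · rw [h1]
    refine (Int.units_eq_one_or _).resolve_left fun h2 => ?_
    rw [h.1 h2] at h1
    exact absurd h1 (by decide)

section

variable (p : ℕ) [Fact p.Prime] {k : Type*} [Field k] [CharP k p] {n : ℕ} (i : ℕ)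

theorem toEnd_fieldAut (s : SO k n) : toEnd (fieldAut p k n i s) =
    Matrix.toLin' (((s : GL (Fin (2 * n + 1)) k) : Matrix (Fin (2 * n + 1)) (Fin (2 * n + 1)) k).map
      (iterateFrobenius k p i)) := rfl

theorem mult_fieldAut [Finite k] (Γ : k[X]) (s : SO k n) :
    mult (fieldPoly p i Γ) (fieldAut p k n i s) = mult Γ s := by
  have h : (toEnd (fieldAut p k n i s)).charpoly = fieldPoly p i (toEnd s).charpoly := by
    rw [toEnd_fieldAut, toEnd, fieldPoly, Matrix.charpoly_toLin', Matrix.charpoly_toLin',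
      Matrix.charpoly_map]
  rw [mult, mult, h]
  exact multiplicity_map_eq (Polynomial.mapEquiv (iterateFrobeniusEquiv k p i))

theorem eta_fieldAut [Finite k] (Γ : k[X]) (s : SO k n) :
    eta (fieldPoly p i Γ) (fieldAut p k n i s) = eta Γ s := by
  refine wittType_map (iterateFrobeniusEquiv k p i) fun v => ?_
  have h := map_aeval_toLin' (iterateFrobenius k p i)
    ((s : GL (Fin (2 * n + 1)) k) : Matrix (Fin (2 * n + 1)) (Fin (2 * n + 1)) k) Γ v
  rw [primaryPart, primaryPart, LinearMap.mem_ker, LinearMap.mem_ker, toEnd_fieldAut, fieldPoly]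
  refine Iff.trans ?_ (iff_of_eq (congrArg (· = 0) h.symm))
  constructor
  · intro h0
    change _ ∘ (aeval (toEnd s) Γ v) = 0
    rw [h0]; ext; simp
  · intro h0
    ext j
    exact (iterateFrobenius k p i).injective ((congrFun h0 j).trans (map_zero _).symm)

end

end OddOrth

/-! ### Conjugacy in SO -/

namespace OddOrth

section

variable {k : Type*} [Field k]

theorem splitGram_bilin_isSymm (d : ℕ) :
    LinearMap.BilinForm.IsSymm (Matrix.toBilin' (splitGram k d)) := by
  refine ⟨fun x y => ?_⟩
  rw [splitGram_bilin_apply, splitGram_bilin_apply]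
  exact Fintype.sum_equiv Fin.revPerm _ _ fun a => by simp [mul_comm]

theorem splitGram_bilin_nondegenerate {d : ℕ} (x : Fin d → k)
    (h : ∀ y, Matrix.toBilin' (splitGram k d) x y = 0) : x = 0 := by
  ext a
  have h' := h (Pi.single (Fin.rev a) 1)
  rw [splitGram_bilin_apply, Finset.sum_eq_single a] at h'
  · simpa using h'
  · intro b _ hb
    rw [Pi.single_eq_of_ne (by simpa using hb), mul_zero]
  · simp

theorem splitGram_mul_self (d : ℕ) : splitGram k d * splitGram k d = 1 := by
  ext a b
  rw [Matrix.mul_apply, Finset.sum_eq_single (Fin.rev a)]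
  · simp [splitGram, Matrix.one_apply, eq_comm]
  · intro c _ hc
    simp [splitGram, hc]
  · simp

theorem splitGram_bilin_mulVec {d : ℕ} (A : Matrix (Fin d) (Fin d) k) (x y : Fin d → k) :
    Matrix.toBilin' (splitGram k d) (Matrix.toLin' A x) (Matrix.toLin' A y) =
      Matrix.toBilin' (A.transpose * splitGram k d * A) x y := by
  simp only [Matrix.toBilin'_apply', Matrix.toLin'_apply]
  rw [← Matrix.mulVec_mulVec, ← Matrix.mulVec_mulVec, Matrix.dotProduct_mulVec x,
    Matrix.vecMul_transpose]

variable {n : ℕ}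

theorem toEnd_mul (s t : SO k n) : toEnd (s * t) = toEnd s * toEnd t :=
  Matrix.toLin'_mul _ _

theorem toEnd_one : toEnd (1 : SO k n) = 1 := Matrix.toLin'_one

theorem toEnd_pow (s : SO k n) (m : ℕ) : toEnd (s ^ m) = toEnd s ^ m := by
  induction m with
  | zero => exact toEnd_one
  | succ m ih => rw [pow_succ, toEnd_mul, ih, pow_succ]

theorem toEnd_injective : Function.Injective (toEnd : SO k n → _) := fun _ _ h =>
  Subtype.ext (Units.ext (Matrix.toLin'.injective h))

theorem toEnd_isometry (s : SO k n) (x y : Fin (2 * n + 1) → k) :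
    Matrix.toBilin' (splitGram k (2 * n + 1)) (toEnd s x) (toEnd s y) =
      Matrix.toBilin' (splitGram k (2 * n + 1)) x y := by
  rw [toEnd, splitGram_bilin_mulVec, s.2.1]

/-- In odd dimension every isometry lies in `SO` up to sign. -/
theorem exists_toEnd_eq_or_neg {f : Module.End k (Fin (2 * n + 1) → k)}
    (hf : ∀ x y, Matrix.toBilin' (splitGram k (2 * n + 1)) (f x) (f y) =
      Matrix.toBilin' (splitGram k (2 * n + 1)) x y) :
    ∃ g : SO k n, toEnd g = f ∨ toEnd g = -f := by
  obtain ⟨A, rfl⟩ := Matrix.toLin'.surjective f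
  have hA : A.transpose * splitGram k (2 * n + 1) * A = splitGram k (2 * n + 1) := by
    apply Matrix.toBilin'.injective
    refine LinearMap.ext fun x => LinearMap.ext fun y => ?_
    rw [← splitGram_bilin_mulVec, hf]
  have hdet : A.det = 1 ∨ A.det = -1 := by
    have h1 := congrArg Matrix.det hA
    have h2 := congrArg Matrix.det (splitGram_mul_self (k := k) (2 * n + 1))
    rw [Matrix.det_mul, Matrix.det_mul, Matrix.det_transpose] at h1
    rw [Matrix.det_mul, Matrix.det_one] at h2
    rw [← mul_self_eq_one_iff]
    linear_combination (splitGram k (2 * n + 1)).det * h1 + (1 - A.det * A.det) * h2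
  rcases hdet with h | h
  · exact ⟨⟨Matrix.GeneralLinearGroup.mkOfDetNeZero A (by rw [h]; exact one_ne_zero), hA, h⟩,
      Or.inl rfl⟩
  -- Odd dimension makes det(-A) = -det A.
  · have h' : (-A).det = 1 := by
      rw [Matrix.det_neg, h, Fintype.card_fin, pow_succ, pow_mul]
      simp
    refine ⟨⟨Matrix.GeneralLinearGroup.mkOfDetNeZero (-A) (by rw [h']; exact one_ne_zero), ?_, h'⟩,
      Or.inr (map_neg Matrix.toLin' A)⟩
    change (-A).transpose * splitGram k (2 * n + 1) * (-A) = _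
    simpa using hA

variable (p : ℕ) [Fact p.Prime] [CharP k p]

theorem isConj_pow_fieldAut [Finite k] (hp : p ≠ 2) (i : ℕ) (s : SO k n)
    (hs : (toEnd s).IsSemisimple) : IsConj (s ^ p ^ i) (fieldAut p k n i s) := by
  obtain ⟨θ, hθc, hθs, hθB⟩ := hasFrobeniusLift p hp i (splitGram_bilin_isSymm (2 * n + 1))
    splitGram_bilin_nondegenerate hs (toEnd_isometry s)
  have hinj : Function.Injective θ := by
    rw [injective_iff_map_eq_zero]
    intro x hx
    refine splitGram_bilin_nondegenerate x fun y => ?_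
    have h := hθB x y
    rw [hx, map_zero, LinearMap.zero_apply] at h
    exact eq_zero_of_pow_eq_zero h.symm
  let e : (Fin (2 * n + 1) → k) ≃+ (Fin (2 * n + 1) → k) :=
    AddEquiv.ofBijective θ (Finite.injective_iff_bijective.1 hinj)
  have he : ∀ x, e.symm (θ x) = x := e.symm_apply_apply
  -- f = φ θ⁻¹: the two Frobenius semilinearities cancel, leaving a linear map.
  let f : Module.End k (Fin (2 * n + 1) → k) :=
    { toFun := fun x => iterateFrobenius k p i ∘ e.symm x
      map_add' := fun x y => by ext; simp
      map_smul' := fun c x => by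
        obtain ⟨x, rfl⟩ := e.surjective x
        obtain ⟨c, rfl⟩ := (iterateFrobeniusEquiv k p i).surjective c
        rw [iterateFrobeniusEquiv_apply, iterateFrobenius_def]
        change _ ∘ e.symm (_ • θ x) = _ • (_ ∘ e.symm (θ x))
        rw [← hθc, he, he]
        ext j
        simp [iterateFrobenius_def, mul_pow] }
  have hf : ∀ x, f (θ x) = iterateFrobenius k p i ∘ x := fun x => by
    change iterateFrobenius k p i ∘ e.symm (θ x) = _
    rw [he]
  have hfB : ∀ x y, Matrix.toBilin' (splitGram k (2 * n + 1)) (f x) (f y) =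
      Matrix.toBilin' (splitGram k (2 * n + 1)) x y := by
    intro x y
    obtain ⟨x, rfl⟩ := e.surjective x
    obtain ⟨y, rfl⟩ := e.surjective y
    change Matrix.toBilin' _ (f (θ x)) (f (θ y)) = Matrix.toBilin' _ (θ x) (θ y)
    rw [hf, hf, splitGram_bilin_map, hθB, iterateFrobenius_def]
  have hcomm : f * toEnd s ^ p ^ i = toEnd (fieldAut p k n i s) * f := by
    refine LinearMap.ext fun x => ?_
    obtain ⟨x, rfl⟩ := e.surjective x
    change f ((toEnd s ^ p ^ i) (θ x)) = toEnd (fieldAut p k n i s) (f (θ x))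
    rw [← hθs, hf, hf, toEnd_fieldAut]
    have h := map_aeval_toLin' (iterateFrobenius k p i)
      ((s : GL (Fin (2 * n + 1)) k) : Matrix (Fin (2 * n + 1)) (Fin (2 * n + 1)) k) Polynomial.X x
    simp only [Polynomial.map_X, Polynomial.aeval_X] at h
    exact h.symm
  obtain ⟨g, hg⟩ := exists_toEnd_eq_or_neg hfB
  refine isConj_iff.2 ⟨g, mul_inv_eq_iff_eq_mul.2 (toEnd_injective ?_)⟩
  rw [toEnd_mul, toEnd_mul, toEnd_pow]
  rcases hg with hg | hg
  · rw [hg, hcomm]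
  -- The sign cancels in the conjugation, so -f serves as well as f.
  · rw [hg]
    refine LinearMap.ext fun x => ?_
    change -(f * toEnd s ^ p ^ i) x = toEnd (fieldAut p k n i s) (-(f x))
    rw [map_neg, hcomm]
    rfl

/-- If the order were p m, then (s^m - 1)^p = s^(pm) - 1 = 0, so s^m - 1 would be both nilpotent and
semisimple, forcing s^m = 1. -/
theorem coprime_orderOf_of_isSemisimple [Finite k] (s : SO k n) (hs : (toEnd s).IsSemisimple) :
    (orderOf s).Coprime p := by
  rw [Nat.coprime_comm, (Fact.out : p.Prime).coprime_iff_not_dvd]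
  rintro ⟨m, hm⟩
  have hpos : 0 < orderOf s := orderOf_pos s
  have hm0 : 0 < m := Nat.pos_of_ne_zero fun h => by
    rw [hm, h, mul_zero] at hpos
    exact hpos.false
  have h1 : (toEnd s ^ m) ^ p = 1 := by
    rw [← pow_mul, mul_comm m p, ← hm, ← toEnd_pow, pow_orderOf_eq_one, toEnd_one]
  have h2 : (toEnd s ^ m - 1).IsSemisimple := by
    have := Module.End.isSemisimple_sub_algebraMap_iff (f := toEnd s ^ m) (μ := (1 : k))
    rw [map_one] at this
    exact this.2 (hs.pow m)
  have : CharP (Module.End k (Fin (2 * n + 1) → k)) p := charP_of_injective_algebraMap' k p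
  have h3 : IsNilpotent (toEnd s ^ m - 1) :=
    ⟨p, by rw [sub_pow_char_of_commute _ (Commute.one_right _), h1, one_pow, sub_self]⟩
  have h4 := sub_eq_zero.1 (Module.End.eq_zero_of_isNilpotent_isSemisimple h3 h2)
  rw [← toEnd_pow, ← toEnd_one] at h4
  have h5 := Nat.le_of_dvd hm0 (orderOf_dvd_of_pow_eq_one (toEnd_injective h4))
  have h6 := (Fact.out : p.Prime).two_le
  nlinarith

theorem zpowers_pow_eq [Finite k] (i : ℕ) (s : SO k n) (hs : (toEnd s).IsSemisimple) :
    Subgroup.zpowers (s ^ p ^ i) = Subgroup.zpowers s := by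
  refine Subgroup.eq_of_le_of_card_ge (Subgroup.zpowers_le.2 (Subgroup.npow_mem_zpowers s _)) ?_
  rw [Nat.card_zpowers, Nat.card_zpowers,
    ((coprime_orderOf_of_isSemisimple p s hs).pow_right i).orderOf_pow]

end

end OddOrth

theorem mainTheorem9 (p : ℕ) [Fact p.Prime] (hp : p ≠ 2)
    (k : Type*) [Field k] [Finite k] [CharP k p] (n i : ℕ)
    (s : OddOrth.SO k n) (hs : (OddOrth.toEnd s).IsSemisimple) :
    (∀ Γ ∈ OddOrth.elemDivisors k,
      OddOrth.fieldPoly p i Γ ∈ OddOrth.elemDivisors k ∧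
      (OddOrth.fieldPoly p i Γ).aroots (AlgebraicClosure k) =
        (Γ.aroots (AlgebraicClosure k)).map (fun x => x ^ p ^ i) ∧
      OddOrth.mult (OddOrth.fieldPoly p i Γ) (OddOrth.fieldAut p k n i s) =
        OddOrth.mult Γ s ∧
      OddOrth.eta (OddOrth.fieldPoly p i Γ) (OddOrth.fieldAut p k n i s) =
        OddOrth.eta Γ s) ∧
    IsConj (s ^ p ^ i) (OddOrth.fieldAut p k n i s) ∧
    ∃ g : OddOrth.SO k n,
      (Subgroup.zpowers s).map (MulAut.conj g).toMonoidHom =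
        Subgroup.zpowers (OddOrth.fieldAut p k n i s) := by
  have hconj := OddOrth.isConj_pow_fieldAut p hp i s hs
  refine ⟨fun Γ hΓ => ⟨OddOrth.map_mem_elemDivisors (iterateFrobeniusEquiv k p i) hΓ,
    OddOrth.aroots_fieldPoly p i Γ, OddOrth.mult_fieldAut p i Γ s, OddOrth.eta_fieldAut p i Γ s⟩,
    hconj, ?_⟩
  obtain ⟨g, hg⟩ := isConj_iff.1 hconj
  refine ⟨g, ?_⟩
  rw [← OddOrth.zpowers_pow_eq p i s hs, MonoidHom.map_zpowers]
  exact congrArg Subgroup.zpowers hg
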